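/- Let $S$ be a (non-empty) semigroup, $\sigma:S\to S$ an involutive automorphism ($\sigma(xy)=\sigma(x)\sigma(y)$, $\sigma(\sigma(x))=x$) and $\alpha\in\mathbb C$ a constant. A function $\chi:S\to\mathbb C$ is multiplicative if $\chi(xy)=\chi(x)\chi(y)$ for all $x,y\in S$ (the zero function is allowed); for $k:S\to\mathbb C$ put $k^*=k\circ\sigma$, and call $k$ even if $k^*=k$. Call $k$ abelian if $k(xy)=k(yx)$ and $k(xyz)=k(xzy)$ for all $x,y,z\in S$. For $T\subseteq S$ let $T^2=\{xy\mid x,y\in T\}$. For a non-zero multiplicative $\chi$ put $$I_\chi=\{x\in S\mid\chi(x)=0\},\qquad P_\chi=\{p\in I_\chi\setminus I_\chi^2\mid up,\,pv,\,upv\in I_\chi\setminus I_\chi^2\ \text{for all } u,v\in S\setminus I_\chi\}.$$ The solutions $g,f:S\to\mathbb C$ of the functional equation $$g(x\sigma(y))=g(x)g(y)-f(x)f(y)+\alpha f(x\sigma(y)),\qquad x,y\in S,$$ are exactly the pairs in the following families: (1) $\alpha=\pm1$, $f$ is any non-zero function and $g=\alpha f$. (2) $\alpha\neq1$, $f=g\neq0$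 and $g=0$ on $S^2$. (3) $\alpha\neq-1$, $f=-g\neq0$ and $g=0$ on $S^2$. (4) $f=(q+\alpha)\frac{\chi}{2}$ and $g=\left(1\pm\sqrt{1+q^2-\alpha^2}\right)\frac{\chi}{2}$, where $q\in\mathbb C$ is a constant and $\chi$ is a non-zero even multiplicative function. (5) $f=\alpha\frac{\chi_1+\chi_2}{2}+q\frac{\chi_1-\chi_2}{2}$ and $g=\frac{\chi_1+\chi_2}{2}\pm\sqrt{1+q^2-\alpha^2}\,\frac{\chi_1-\chi_2}{2}$, where $\chi_1,\chi_2$ are two different non-zero even multiplicative functions and $q\in\mathbb C\setminus\{\pm\alpha\}$ is a constant. (6) $\alpha\neq0$, $f=\alpha\chi_1$ and $g=\chi_2$, where $\chi_1,\chi_2$ are two different non-zero even multiplicative functions. (7) $f=\alpha\chi+h$ and $g=\chi\pm h$, where $\chi$ is a non-zero even multiplicative function and $$h=\begin{cases}\chi A&\text{on } S\setminus I_\chi,\\ 0&\text{on } I_\chi\setminus P_\chi,\\ \rho&\text{on } P_\chi,\end{cases}$$ with $A:S\setminus I_\chi\to\mathbb C$ additive ($A(xy)=A(x)+A(y)$)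 such that $A\circ\sigma=A$, and $\rho:P_\chi\to\mathbb C$ such that $\rho\circ\sigma=\rho$, subject to the conditions (I) if $p\in P_\chi$ and $u,v\in S\setminus I_\chi$, then $\rho(up)=\rho(p)\chi(u)$, $\rho(pv)=\rho(p)\chi(v)$ and $\rho(upv)=\rho(p)\chi(uv)$ (the elements $up,pv,upv$ belong to $P_\chi$); (II) $h(xy)=h(yx)=0$ for all $x\in I_\chi\setminus P_\chi$ and $y\in S\setminus I_\chi$. (8) $\alpha\neq\pm1$, $f=\frac{1+\alpha}{2}\chi-\frac{1-\alpha}{2}\chi^*$ and $g=\frac{1+\alpha}{2}\chi+\frac{1-\alpha}{2}\chi^*$, where $\chi$ is a multiplicative function with $\chi\neq\chi^*$. In the families (2)–(8), both $g$ and $f$ are abelian. Moreover, suppose that $S$ is a topological semigroup (its multiplication is continuous) and that $(g,f)$ is a solution with $f$ continuous and $f\neq\alpha\chi$ for every continuous multiplicative function $\chi:S\to\mathbb C$. Then $g$ is continuous. -/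

import Mathlib

open scoped Pointwise

namespace CosineLaw

variable {S : Type*} [Semigroup S]

/-- `g(xσ(y)) = g(x)g(y) - f(x)f(y) + α f(xσ(y))` for all `x, y`. -/
def IsSolution (σ : S ≃* S) (α : ℂ) (g f : S → ℂ) : Prop :=
  ∀ x y : S, g (x * σ y) = g x * g y - f x * f y + α * f (x * σ y)

/-- `f` is even: `f ∘ σ = f`. -/
def IsEven (σ : S ≃* S) (f : S → ℂ) : Prop := ∀ x : S, f (σ x) = f x

/-- `f` is abelian: central, and `f(xyz) = f(xzy)`. -/
def IsAbelian (f : S → ℂ) : Prop :=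
  (∀ x y : S, f (x * y) = f (y * x)) ∧ ∀ x y z : S, f (x * y * z) = f (x * z * y)

/-- `f = 0` on `S²`. -/
def VanishesOnProducts (f : S → ℂ) : Prop := ∀ x y : S, f (x * y) = 0

/-- `I_χ`, the zero set of `χ`. -/
def nullSet (χ : S →ₙ* ℂ) : Set S := {x | χ x = 0}

/-- `S \ I_χ`, as a subsemigroup of `S`. -/
def supp (χ : S →ₙ* ℂ) : Subsemigroup S where
  carrier := (nullSet χ)ᶜ
  mul_mem' := by
    intro a b ha hb
    have ha' : χ a ≠ 0 := ha
    have hb' : χ b ≠ 0 := hb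
    change χ (a * b) ≠ 0
    rw [map_mul]
    exact mul_ne_zero ha' hb'

/-- `P_χ`; here `nullSet χ * nullSet χ` is the set of products of two elements of `I_χ`. -/
def pSet (χ : S →ₙ* ℂ) : Set S :=
  {p | p ∈ nullSet χ \ (nullSet χ * nullSet χ) ∧
    ∀ u ∈ supp χ, ∀ v ∈ supp χ,
      u * p ∈ nullSet χ \ (nullSet χ * nullSet χ) ∧
      p * v ∈ nullSet χ \ (nullSet χ * nullSet χ) ∧
      u * p * v ∈ nullSet χ \ (nullSet χ * nullSet χ)}

theorem map_mem_supp {σ : S ≃* S} {χ : S →ₙ* ℂ} (hχ : IsEven σ χ) {x : S}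
    (hx : x ∈ supp χ) : σ x ∈ supp χ := by
  have h : χ x ≠ 0 := hx
  change χ (σ x) ≠ 0
  rwa [hχ x]

theorem map_mem_nullSet_diff {σ : S ≃* S} {χ : S →ₙ* ℂ} (hσ : Function.Involutive σ)
    (hχ : IsEven σ χ) {x : S} (hx : x ∈ nullSet χ \ (nullSet χ * nullSet χ)) :
    σ x ∈ nullSet χ \ (nullSet χ * nullSet χ) := by
  obtain ⟨h1, h2⟩ := hx
  have key : ∀ y : S, y ∈ nullSet χ → σ y ∈ nullSet χ := by
    intro y hy
    have h : χ y = 0 := hy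
    change χ (σ y) = 0
    rw [hχ y, h]
  refine ⟨key x h1, ?_⟩
  rintro ⟨a, ha, b, hb, hab⟩
  refine h2 ⟨σ a, key a ha, σ b, key b hb, ?_⟩
  have h := congrArg σ hab
  simpa [hσ x] using h

theorem map_mem_pSet {σ : S ≃* S} {χ : S →ₙ* ℂ} (hσ : Function.Involutive σ)
    (hχ : IsEven σ χ) {p : S} (hp : p ∈ pSet χ) : σ p ∈ pSet χ := by
  obtain ⟨h1, h2⟩ := hp
  refine ⟨map_mem_nullSet_diff hσ hχ h1, fun u hu v hv => ?_⟩
  obtain ⟨a, b, c⟩ := h2 (σ u) (map_mem_supp hχ hu) (σ v) (map_mem_supp hχ hv)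
  have a' := map_mem_nullSet_diff hσ hχ a
  have b' := map_mem_nullSet_diff hσ hχ b
  have c' := map_mem_nullSet_diff hσ hχ c
  simp only [map_mul, hσ u, hσ v] at a' b' c'
  exact ⟨a', b', c'⟩

/-- `h` is `χA` on `S \ I_χ`, `0` on `I_χ \ P_χ` and `ρ` on `P_χ`. -/
def IsPiecewise (χ : S →ₙ* ℂ) (A : supp χ → ℂ) (ρ : pSet χ → ℂ) (h : S → ℂ) : Prop :=
  (∀ u : supp χ, h u = χ u * A u) ∧
  (∀ x ∈ nullSet χ \ pSet χ, h x = 0) ∧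
  (∀ p : pSet χ, h p = ρ p)

/-- Condition (I). -/
def ConditionI (χ : S →ₙ* ℂ) (ρ : pSet χ → ℂ) : Prop :=
  ∀ (x p : pSet χ) (u v : supp χ),
    ((x : S) = u * p → ρ x = ρ p * χ u) ∧
    ((x : S) = p * v → ρ x = ρ p * χ v) ∧
    ((x : S) = u * p * v → ρ x = ρ p * χ (u * v))

/-- Condition (II). -/
def ConditionII (χ : S →ₙ* ℂ) (h : S → ℂ) : Prop :=
  ∀ x ∈ nullSet χ \ pSet χ, ∀ y ∈ supp χ, h (x * y) = 0 ∧ h (y * x) = 0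

def Family1 (α : ℂ) (g f : S → ℂ) : Prop :=
  (α = 1 ∨ α = -1) ∧ f ≠ 0 ∧ ∀ x, g x = α * f x

def Family2 (α : ℂ) (g f : S → ℂ) : Prop :=
  α ≠ 1 ∧ f = g ∧ g ≠ 0 ∧ VanishesOnProducts g

def Family3 (α : ℂ) (g f : S → ℂ) : Prop :=
  α ≠ -1 ∧ f = -g ∧ g ≠ 0 ∧ VanishesOnProducts g

/-- Here `s` is a square root of `1 + q² - α²`. -/
def Family4 (σ : S ≃* S) (α : ℂ) (g f : S → ℂ) : Prop :=
  ∃ (q s : ℂ) (χ : S →ₙ* ℂ), s ^ 2 = 1 + q ^ 2 - α ^ 2 ∧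
    (χ : S → ℂ) ≠ 0 ∧ IsEven σ χ ∧
    (∀ x, f x = (q + α) * (χ x / 2)) ∧
    ((∀ x, g x = (1 + s) * (χ x / 2)) ∨ (∀ x, g x = (1 - s) * (χ x / 2)))

/-- Here `s` is a square root of `1 + q² - α²`. -/
def Family5 (σ : S ≃* S) (α : ℂ) (g f : S → ℂ) : Prop :=
  ∃ (q s : ℂ) (χ₁ χ₂ : S →ₙ* ℂ), s ^ 2 = 1 + q ^ 2 - α ^ 2 ∧ q ≠ α ∧ q ≠ -α ∧
    χ₁ ≠ χ₂ ∧ (χ₁ : S → ℂ) ≠ 0 ∧ (χ₂ : S → ℂ) ≠ 0 ∧ IsEven σ χ₁ ∧ IsEven σ χ₂ ∧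
    (∀ x, f x = α * ((χ₁ x + χ₂ x) / 2) + q * ((χ₁ x - χ₂ x) / 2)) ∧
    ((∀ x, g x = (χ₁ x + χ₂ x) / 2 + s * ((χ₁ x - χ₂ x) / 2)) ∨
      (∀ x, g x = (χ₁ x + χ₂ x) / 2 - s * ((χ₁ x - χ₂ x) / 2)))

def Family6 (σ : S ≃* S) (α : ℂ) (g f : S → ℂ) : Prop :=
  α ≠ 0 ∧ ∃ χ₁ χ₂ : S →ₙ* ℂ,
    χ₁ ≠ χ₂ ∧ (χ₁ : S → ℂ) ≠ 0 ∧ (χ₂ : S → ℂ) ≠ 0 ∧ IsEven σ χ₁ ∧ IsEven σ χ₂ ∧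
    (∀ x, f x = α * χ₁ x) ∧ (∀ x, g x = χ₂ x)

/-- `A` is additive on `S \ I_χ` with `A ∘ σ = A`, and `ρ ∘ σ = ρ` on `P_χ`. -/
def Family7 (σ : S ≃* S) (hσ : Function.Involutive σ) (α : ℂ) (g f : S → ℂ) : Prop :=
  ∃ (χ : S →ₙ* ℂ) (hχ : IsEven σ χ) (A : supp χ → ℂ) (ρ : pSet χ → ℂ) (h : S → ℂ),
    (χ : S → ℂ) ≠ 0 ∧
    (∀ u v : supp χ, A (u * v) = A u + A v) ∧
    (∀ u : supp χ, A ⟨σ u, map_mem_supp hχ u.2⟩ = A u) ∧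
    (∀ p : pSet χ, ρ ⟨σ p, map_mem_pSet hσ hχ p.2⟩ = ρ p) ∧
    IsPiecewise χ A ρ h ∧ ConditionI χ ρ ∧ ConditionII χ h ∧
    (∀ x, f x = α * χ x + h x) ∧
    ((∀ x, g x = χ x + h x) ∨ (∀ x, g x = χ x - h x))

def Family8 (σ : S ≃* S) (α : ℂ) (g f : S → ℂ) : Prop :=
  α ≠ 1 ∧ α ≠ -1 ∧ ∃ χ : S →ₙ* ℂ, ¬ IsEven σ χ ∧
    (∀ x, f x = (1 + α) / 2 * χ x - (1 - α) / 2 * χ (σ x)) ∧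
    (∀ x, g x = (1 + α) / 2 * χ x + (1 - α) / 2 * χ (σ x))

/-- The families (2)-(8), that is, all but the exceptional family (1). -/
def RegularFamilies (σ : S ≃* S) (hσ : Function.Involutive σ) (α : ℂ) (g f : S → ℂ) : Prop :=
  Family2 α g f ∨ Family3 α g f ∨ Family4 σ α g f ∨ Family5 σ α g f ∨
    Family6 σ α g f ∨ Family7 σ hσ α g f ∨ Family8 σ α g f

end CosineLaw

namespace CosineLaw

/-! Suppose `g` and `f` are linearly independent. Expanding `g(wσ(y)σ(z))` in two ways gives
`g(yz)g(w) - f(yz)f(w) = g(wσ(y))g(z) - f(wσ(y))f(z)`. Hence left translation by `y` acts on the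
span of `g, f` by a 2×2 matrix `M(y)`, and right translation by `σ y` acts by its adjoint `M(y)*`
for the form `gg' - ff'` (`IsSolution.exists_isTransfer`). `M` is multiplicative and, since left and
right translations commute, `M(y)` commutes with every `M(x)*`. This leaves three shapes
(`IsTransfer.trichotomy`): all `M(y)` diagonal, giving `Family6`; all in the span of the identity
and the swap, giving `Family8`; or all self-adjoint in the span of the identity and one further
matrix, whose eigenvalues yield `Family5` or `Family6` if distinct and the sine law of `Family7` if
equal. In the dependent case everything is a multiple of one function `k`, and the equation makes
`k(xσ(y))` proportional to `k(x)k(y)`. -/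

/-! ### Linear independence of two functions. -/

/-- `g` and `f` are linearly independent functions. -/
def Independent {X : Type*} (g f : X → ℂ) : Prop :=
  ∀ u v : ℂ, (∀ x, u * g x + v * f x = 0) → u = 0 ∧ v = 0

theorem Independent.ext {X : Type*} {g f : X → ℂ} (hi : Independent g f) {u v u' v' : ℂ}
    (h : ∀ x, u * g x + v * f x = u' * g x + v' * f x) : u = u' ∧ v = v' := by
  obtain ⟨h1, h2⟩ := hi (u - u') (v - v') fun x => by linear_combination h x
  exact ⟨sub_eq_zero.1 h1, sub_eq_zero.1 h2⟩

theorem Independent.exists_det_ne_zero {X : Type*} {g f : X → ℂ} (hi : Independent g f) :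
    ∃ x y, g x * f y - g y * f x ≠ 0 := by
  by_contra! H
  have hf : ∀ y, f y = 0 := fun y =>
    (hi (f y) (-g y) fun x => by linear_combination H x y).1
  exact one_ne_zero (hi 0 1 fun x => by rw [hf]; ring).2

theorem exists_smul_of_not_independent {X : Type*} {g f : X → ℂ} (h : ¬ Independent g f)
    (hf : f ≠ 0) : ∃ u : ℂ, g = fun x => u * f x := by
  unfold Independent at h
  push Not at h
  obtain ⟨u, v, h, hn⟩ := h
  obtain ⟨p, hp⟩ := Function.ne_iff.1 hf
  have hu : u ≠ 0 := by
    rintro rfl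
    have := h p
    rw [zero_mul, zero_add] at this
    exact (mul_ne_zero (hn rfl) hp) this
  refine ⟨-v / u, funext fun x => ?_⟩
  field_simp
  linear_combination h x

variable {S : Type*} [Semigroup S]

/-! ### The sine addition law and the structure of its solutions. -/

/-- The sine addition law `h(xy) = h(x)χ(y) + χ(x)h(y)`. -/
def SineLaw (χ : S →ₙ* ℂ) (h : S → ℂ) : Prop :=
  ∀ x y : S, h (x * y) = h x * χ y + χ x * h y

theorem mul_mem_pSet {χ : S →ₙ* ℂ} {p u v : S} (hp : p ∈ pSet χ) (hu : u ∈ supp χ)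
    (hv : v ∈ supp χ) : u * p ∈ pSet χ ∧ p * v ∈ pSet χ ∧ u * p * v ∈ pSet χ := by
  have left : ∀ {p u : S}, p ∈ pSet χ → u ∈ supp χ → u * p ∈ pSet χ := by
    intro p u hp hu
    -- The component used involves one multiplier only; the second `u` merely fills the other
    -- quantifier.
    refine ⟨(hp.2 u hu u hu).1, fun w hw z hz => ?_⟩
    have h1 := hp.2 (w * u) (mul_mem hw hu) z hz
    have h2 := hp.2 u hu z hz
    rw [← mul_assoc]
    exact ⟨h1.1, h2.2.2, h1.2.2⟩
  have right : ∀ {p v : S}, p ∈ pSet χ → v ∈ supp χ → p * v ∈ pSet χ := by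
    intro p v hp hv
    refine ⟨(hp.2 v hv v hv).2.1, fun w hw z hz => ?_⟩
    have h1 := hp.2 w hw (v * z) (mul_mem hv hz)
    have h2 := hp.2 w hw v hv
    simp only [← mul_assoc] at h1 h2 ⊢
    exact ⟨h2.2.2, h1.2.1, h1.2.2⟩
  exact ⟨left hp hu, right hp hv, right (left hp hu) hv⟩

theorem mul_notMem_pSet {χ : S →ₙ* ℂ} {x y : S} (hx : χ x = 0) (hy : χ y = 0) :
    x * y ∈ nullSet χ \ pSet χ :=
  ⟨by change χ (x * y) = 0; simp [hx], fun h => h.1.2 ⟨x, hx, y, hy, rfl⟩⟩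

theorem IsPiecewise.sineLaw {χ : S →ₙ* ℂ} {A : supp χ → ℂ} {ρ : pSet χ → ℂ} {h : S → ℂ}
    (hA : ∀ u v : supp χ, A (u * v) = A u + A v) (hh : IsPiecewise χ A ρ h)
    (hI : ConditionI χ ρ) (hII : ConditionII χ h) : SineLaw χ h := by
  obtain ⟨h1, h2, h3⟩ := hh
  intro x y
  by_cases hx : χ x = 0 <;> by_cases hy : χ y = 0
  · rw [h2 _ (mul_notMem_pSet hx hy), hx, hy]; ring
  · by_cases hp : x ∈ pSet χ
    · have hq := (mul_mem_pSet hp (u := y) hy (v := y) hy).2.1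
      rw [h3 ⟨_, hq⟩, h3 ⟨x, hp⟩, (hI ⟨_, hq⟩ ⟨x, hp⟩ ⟨y, hy⟩ ⟨y, hy⟩).2.1 rfl, hx]; ring
    · rw [(hII x ⟨hx, hp⟩ y hy).1, h2 x ⟨hx, hp⟩, hx]; ring
  · by_cases hp : y ∈ pSet χ
    · have hq := (mul_mem_pSet hp (u := x) hx (v := x) hx).1
      rw [h3 ⟨_, hq⟩, h3 ⟨y, hp⟩, (hI ⟨_, hq⟩ ⟨y, hp⟩ ⟨x, hx⟩ ⟨x, hx⟩).1 rfl, hy]; ring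
    · rw [(hII y ⟨hy, hp⟩ x hx).2, h2 y ⟨hy, hp⟩, hy]; ring
  · replace hx : x ∈ supp χ := hx
    replace hy : y ∈ supp χ := hy
    have e1 := h1 ⟨x, hx⟩
    have e2 := h1 ⟨y, hy⟩
    have e3 := h1 (⟨x, hx⟩ * ⟨y, hy⟩)
    rw [hA] at e3
    simp only [MulMemClass.mk_mul_mk, map_mul] at e1 e2 e3
    rw [e1, e2, e3]; ring

theorem IsPiecewise.isEven {σ : S ≃* S} (hσ : Function.Involutive σ) {χ : S →ₙ* ℂ}
    (hχ : IsEven σ χ) {A : supp χ → ℂ} {ρ : pSet χ → ℂ} {h : S → ℂ}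
    (hA : ∀ u : supp χ, A ⟨σ u, map_mem_supp hχ u.2⟩ = A u)
    (hρ : ∀ p : pSet χ, ρ ⟨σ p, map_mem_pSet hσ hχ p.2⟩ = ρ p)
    (hh : IsPiecewise χ A ρ h) : IsEven σ h := by
  obtain ⟨h1, h2, h3⟩ := hh
  intro x
  by_cases hx : χ x = 0
  · by_cases hp : x ∈ pSet χ
    · rw [h3 ⟨σ x, map_mem_pSet hσ hχ hp⟩, h3 ⟨x, hp⟩, hρ ⟨x, hp⟩]
    · have hp' : σ x ∉ pSet χ := fun h => hp (by simpa [hσ x] using map_mem_pSet hσ hχ h)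
      rw [h2 x ⟨hx, hp⟩, h2 (σ x) ⟨(hχ x).trans hx, hp'⟩]
  · rw [h1 ⟨σ x, map_mem_supp hχ hx⟩, h1 ⟨x, hx⟩, hA ⟨x, hx⟩, hχ x]

/-- By the sine law `h` vanishes on `I_χ²`, while multiplying `x ∈ I_χ` by elements of `supp χ`
scales `h x` by non-zero factors. So `h x ≠ 0` keeps `x` and all its translates out of `I_χ²`, which
places `x` in `P_χ`. -/
theorem SineLaw.eq_zero {χ : S →ₙ* ℂ} {h : S → ℂ} (hh : SineLaw χ h) {x : S}
    (hx : x ∈ nullSet χ \ pSet χ) : h x = 0 := by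
  obtain ⟨hx0, hxp⟩ := hx
  change χ x = 0 at hx0
  have key : ∀ y ∈ nullSet χ * nullSet χ, h y = 0 := by
    rintro _ ⟨a, ha, b, hb, rfl⟩
    change χ a = 0 at ha
    change χ b = 0 at hb
    rw [hh, ha, hb]; ring
  by_contra hne
  refine hxp ⟨⟨hx0, fun h2 => hne (key x h2)⟩, fun u hu v hv => ?_⟩
  change χ u ≠ 0 at hu
  change χ v ≠ 0 at hv
  refine ⟨⟨?_, fun h2 => ?_⟩, ⟨?_, fun h2 => ?_⟩, ⟨?_, fun h2 => ?_⟩⟩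
  · change χ _ = 0; simp [hx0]
  · simpa [hh u x, hx0, hu, hne] using key _ h2
  · change χ _ = 0; simp [hx0]
  · simpa [hh x v, hx0, hv, hne] using key _ h2
  · change χ _ = 0; simp [hx0]
  · simpa [hh (u * x) v, hh u x, hx0, hu, hv, hne] using key _ h2

/-- Dividing by `χ` turns the sine law into additivity, so `A = h / χ` on `supp χ` and `ρ` is the
restriction of `h`. -/
theorem SineLaw.family7 {σ : S ≃* S} (hσ : Function.Involutive σ) {α : ℂ} {g f : S → ℂ}
    {χ : S →ₙ* ℂ} {h : S → ℂ} (hh : SineLaw χ h) (hχ : IsEven σ χ) (he : IsEven σ h)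
    (h0 : (χ : S → ℂ) ≠ 0) (hf : ∀ x, f x = α * χ x + h x)
    (hg : (∀ x, g x = χ x + h x) ∨ (∀ x, g x = χ x - h x)) : Family7 σ hσ α g f := by
  refine ⟨χ, hχ, fun u => h u / χ u, fun p => h p, h, h0, fun u v => ?_, fun u => ?_,
    fun p => he p, ⟨fun u => ?_, fun x hx => hh.eq_zero hx, fun p => rfl⟩,
    fun x p u v => ?_, fun x hx y hy => ?_, hf, hg⟩
  · have hu : χ u ≠ 0 := u.2
    have hv : χ v ≠ 0 := v.2
    simp only [MulMemClass.coe_mul, map_mul, hh (u : S) v]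
    field_simp
  · simp only [he (u : S), hχ (u : S)]
  · have hu : χ u ≠ 0 := u.2
    field_simp
  · have hp : χ p = 0 := p.2.1.1
    refine ⟨fun e => ?_, fun e => ?_, fun e => ?_⟩
    · simp only [e, hh _ _, hp]; ring
    · simp only [e, hh _ _, hp]; ring
    · simp only [e, hh _ _, hp, map_mul]; ring
  · have hx0 : χ x = 0 := hx.1
    rw [hh, hh, hx0, hh.eq_zero hx]
    simp

/-! ### The listed families are abelian and solve the equation. -/

theorem RegularFamilies.isAbelian {σ : S ≃* S} {hσ : Function.Involutive σ} {α : ℂ}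
    {g f : S → ℂ} (H : RegularFamilies σ hσ α g f) : IsAbelian g ∧ IsAbelian f := by
  have lin : ∀ (χ₁ χ₂ : S →ₙ* ℂ) (k : S → ℂ) (a b : ℂ), (∀ x, k x = a * χ₁ x + b * χ₂ x) →
      IsAbelian k := by
    intro χ₁ χ₂ k a b hk
    refine ⟨fun x y => ?_, fun x y z => ?_⟩ <;> simp only [hk, map_mul] <;> ring
  have lin' : ∀ (χ : S →ₙ* ℂ) (h k : S → ℂ) (a b : ℂ), SineLaw χ h →
      (∀ x, k x = a * χ x + b * h x) → IsAbelian k := by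
    intro χ h k a b hh hk
    refine ⟨fun x y => ?_, fun x y z => ?_⟩ <;> simp only [hk, hh _ _, map_mul] <;> ring
  rcases H with ⟨-, rfl, -, hv⟩ | ⟨-, rfl, -, hv⟩ | ⟨q, s, χ, -, -, -, hf, hg⟩ |
    ⟨q, s, χ₁, χ₂, -, -, -, -, -, -, -, -, hf, hg⟩ | ⟨-, χ₁, χ₂, -, -, -, -, -, hf, hg⟩ |
    ⟨χ, hχ, A, ρ, h, -, hA, -, -, hh, hI, hII, hf, hg⟩ | ⟨-, -, χ, -, hf, hg⟩
  · have : IsAbelian f := ⟨fun x y => by rw [hv, hv], fun x y z => by rw [hv, hv]⟩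
    exact ⟨this, this⟩
  · refine ⟨⟨fun x y => ?_, fun x y z => ?_⟩, ⟨fun x y => ?_, fun x y z => ?_⟩⟩ <;>
      simp only [Pi.neg_apply, hv _ _]
  · refine ⟨?_, lin χ χ f ((q + α) / 2) 0 fun x => by rw [hf]; ring⟩
    rcases hg with hg | hg
    · exact lin χ χ g ((1 + s) / 2) 0 fun x => by rw [hg]; ring
    · exact lin χ χ g ((1 - s) / 2) 0 fun x => by rw [hg]; ring
  · refine ⟨?_, lin χ₁ χ₂ f ((α + q) / 2) ((α - q) / 2) fun x => by rw [hf]; ring⟩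
    rcases hg with hg | hg
    · exact lin χ₁ χ₂ g ((1 + s) / 2) ((1 - s) / 2) fun x => by rw [hg]; ring
    · exact lin χ₁ χ₂ g ((1 - s) / 2) ((1 + s) / 2) fun x => by rw [hg]; ring
  · exact ⟨lin χ₁ χ₂ g 0 1 fun x => by rw [hg]; ring, lin χ₁ χ₂ f α 0 fun x => by rw [hf]; ring⟩
  · have hs := hh.sineLaw hA hI hII
    refine ⟨?_, lin' χ h f α 1 hs fun x => by rw [hf]; ring⟩
    rcases hg with hg | hg
    · exact lin' χ h g 1 1 hs fun x => by rw [hg]; ring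
    · exact lin' χ h g 1 (-1) hs fun x => by rw [hg]; ring
  · exact ⟨lin χ (χ.comp σ) g _ _ hg, lin χ (χ.comp σ) f ((1 + α) / 2) (-((1 - α) / 2))
      fun x => by rw [hf]; simp; ring⟩

theorem Family1.isSolution (σ : S ≃* S) {α : ℂ} {g f : S → ℂ} (H : Family1 α g f) :
    IsSolution σ α g f := by
  obtain ⟨hα, -, hg⟩ := H
  have h2 : α ^ 2 = 1 := by rcases hα with rfl | rfl <;> norm_num
  intro x y
  rw [hg, hg, hg]
  linear_combination (-f x * f y) * h2

theorem RegularFamilies.isSolution {σ : S ≃* S} {hσ : Function.Involutive σ} {α : ℂ}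
    {g f : S → ℂ} (H : RegularFamilies σ hσ α g f) : IsSolution σ α g f := by
  intro x y
  rcases H with ⟨-, rfl, -, hv⟩ | ⟨-, rfl, -, hv⟩ | ⟨q, s, χ, hs, -, hχ, hf, hg⟩ |
    ⟨q, s, χ₁, χ₂, hs, -, -, -, -, -, h₁, h₂, hf, hg⟩ | ⟨-, χ₁, χ₂, -, -, -, h₁, h₂, hf, hg⟩ |
    ⟨χ, hχ, A, ρ, h, -, hA, hA', hρ, hh, hI, hII, hf, hg⟩ | ⟨-, -, χ, -, hf, hg⟩
  · rw [hv]; ring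
  · simp only [Pi.neg_apply, hv _ _]; ring
  · rcases hg with hg | hg
    all_goals
      simp only [hf, hg, map_mul, hχ y]
      linear_combination (-χ x * χ y / 4) * hs
  · rcases hg with hg | hg
    all_goals
      simp only [hf, hg, map_mul, h₁ y, h₂ y]
      linear_combination (-(χ₁ x - χ₂ x) * (χ₁ y - χ₂ y) / 4) * hs
  · simp only [hf, hg, map_mul, h₁ y, h₂ y]; ring
  · have hs := hh.sineLaw hA hI hII
    have he := hh.isEven hσ hχ hA' hρ
    rcases hg with hg | hg
    all_goals
      simp only [hf, hg, map_mul, hs x _, hχ y, he y]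
      ring
  · simp only [hf, hg, map_mul, hσ y]; ring

/-! ### Transfer matrices of an independent solution. -/

/-- Translations act on the span of `g` and `f`: left translation by `y` through the matrix
with rows `(a y, b y)` and `(c y, d y)`, right translation by `σ y` through its adjoint for the
form `gg' - ff'`. -/
structure IsTransfer (σ : S ≃* S) (α : ℂ) (g f a b c d : S → ℂ) : Prop where
  left_g : ∀ y z, g (y * z) = a y * g z + b y * f z
  left_f : ∀ y z, f (y * z) = c y * g z + d y * f z
  right_g : ∀ w y, g (w * σ y) = a y * g w - c y * f w
  right_f : ∀ w y, f (w * σ y) = -b y * g w + d y * f w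
  eq_g : ∀ y, g y = a y + α * b y
  eq_f : ∀ y, f y = c y + α * d y

theorem IsSolution.exists_isTransfer {σ : S ≃* S} {α : ℂ}
    {g f : S → ℂ} (H : IsSolution σ α g f) (hi : Independent g f) :
    ∃ a b c d : S → ℂ, IsTransfer σ α g f a b c d := by
  have sym : ∀ y z w, g (y * z) * g w - f (y * z) * f w
      = g (w * σ y) * g z - f (w * σ y) * f z := by
    intro y z w
    have h1 := H w (y * z)
    have h2 := H (w * σ y) z
    rw [map_mul, ← mul_assoc] at h1
    linear_combination h2 - h1
  obtain ⟨p, q, hD⟩ := hi.exists_det_ne_zero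
  set D := g p * f q - g q * f p with hDdef
  have hleft : ∀ y, ∃ a b c d : ℂ, ∀ z, g (y * z) = a * g z + b * f z ∧
      f (y * z) = c * g z + d * f z := by
    intro y
    -- Cramer's rule for `sym y z w` at `w = p` and `w = q`, as a linear system in `g (y * z)` and
    -- `f (y * z)`.
    refine ⟨(f q * g (p * σ y) - f p * g (q * σ y)) / D,
      -(f q * f (p * σ y) - f p * f (q * σ y)) / D,
      (g q * g (p * σ y) - g p * g (q * σ y)) / D,
      -(g q * f (p * σ y) - g p * f (q * σ y)) / D, fun z => ⟨?_, ?_⟩⟩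
    · field_simp
      linear_combination f q * sym y z p - f p * sym y z q + g (y * z) * hDdef
    · field_simp
      linear_combination g q * sym y z p - g p * sym y z q + f (y * z) * hDdef
  choose a b c d hl using hleft
  have hr : ∀ w y, g (w * σ y) = a y * g w - c y * f w ∧
      f (w * σ y) = -b y * g w + d y * f w := by
    intro w y
    have := hi.ext (u := g (w * σ y)) (v := -f (w * σ y)) (u' := a y * g w - c y * f w)
      (v' := b y * g w - d y * f w) fun z => by
        have := sym y z w
        rw [(hl y z).1, (hl y z).2] at this
        linear_combination -this
    exact ⟨this.1, by linear_combination -this.2⟩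
  have he : ∀ y, g y = a y + α * b y ∧ -f y = -(c y + α * d y) := fun y =>
    hi.ext fun x => by
      have := H x y
      rw [(hr x y).1, (hr x y).2] at this
      linear_combination -this
  exact ⟨a, b, c, d, fun y z => (hl y z).1, fun y z => (hl y z).2, fun w y => (hr w y).1,
    fun w y => (hr w y).2, fun y => (he y).1, fun y => neg_injective (he y).2⟩

namespace IsTransfer

variable {σ : S ≃* S} {α : ℂ} {g f a b c d : S → ℂ}

theorem mul_entries (T : IsTransfer σ α g f a b c d) (hi : Independent g f) (x y : S) :
    (a (x * y) = a x * a y + b x * c y ∧ b (x * y) = a x * b y + b x * d y) ∧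
    (c (x * y) = c x * a y + d x * c y ∧ d (x * y) = c x * b y + d x * d y) := by
  constructor
  · refine hi.ext fun z => ?_
    rw [← T.left_g, mul_assoc, T.left_g, T.left_g, T.left_f]; ring
  · refine hi.ext fun z => ?_
    rw [← T.left_f, mul_assoc, T.left_f, T.left_g, T.left_f]; ring

/-- Entrywise form of `M(y)M(x)* = M(x)*M(y)`, obtained by bracketing `y w σ(x)` in two ways. -/
theorem commute_adjoint (T : IsTransfer σ α g f a b c d) (hi : Independent g f) (x y : S) :
    c y * c x = b y * b x ∧ (a y - d y) * c x = b y * (d x - a x) ∧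
      (a y - d y) * b x = c y * (d x - a x) := by
  have h1 : a y * a x - b y * b x = a x * a y - c x * c y ∧
      -(a y * c x) + b y * d x = a x * b y - c x * d y := hi.ext fun w => by
    have := congrArg g (mul_assoc y w (σ x))
    rw [T.right_g, T.left_g, T.left_f, T.left_g, T.right_g, T.right_f] at this
    linear_combination -this
  have h2 : c y * a x - d y * b x = -b x * a y + d x * c y ∧
      -(c y * c x) + d y * d x = -b x * b y + d x * d y := hi.ext fun w => by
    have := congrArg f (mul_assoc y w (σ x))
    rw [T.right_f, T.left_g, T.left_f, T.left_f, T.right_g, T.right_f] at this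
    linear_combination -this
  exact ⟨by linear_combination h1.1, by linear_combination -h1.2, by linear_combination h2.1⟩

/-- The matrices kill the defect between the adjoint and the composition with `σ`. -/
theorem defect (T : IsTransfer σ α g f a b c d) (hi : Independent g f) (x y : S) :
    a x * (a y - α * c y - g (σ y)) + b x * (-b y + α * d y - f (σ y)) = 0 ∧
    c x * (a y - α * c y - g (σ y)) + d x * (-b y + α * d y - f (σ y)) = 0 := by
  -- With `e = (1, α)`, `M(x)e = (g, f)(x)`. Hence `M(x)M(y)*e = M(y)*M(x)e = (g, f)(xσ(y)) =
  -- M(x)(g, f)(σ(y))`.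
  obtain ⟨h1, h2, h3⟩ := T.commute_adjoint hi y x
  have hg := T.left_g x (σ y)
  have hf := T.left_f x (σ y)
  rw [T.right_g, T.eq_g x, T.eq_f x] at hg
  rw [T.right_f, T.eq_g x, T.eq_f x] at hf
  constructor
  · linear_combination hg + h1 - α * h2
  · linear_combination hf + h3 - α * h1

/-- `c y * c x = b y * b x` at `x = y` gives `c y = ±b y`; a single `y` with `b y ≠ 0` then fixes
the sign, and the ratio `k`, for every `x`. -/
theorem trichotomy (T : IsTransfer σ α g f a b c d) (hi : Independent g f) :
    (∀ x, b x = 0 ∧ c x = 0) ∨ (∃ x, b x ≠ 0) ∧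
      ((∀ x, c x = b x ∧ a x = d x) ∨ ∃ k, ∀ x, c x = -b x ∧ a x = d x + k * b x) := by
  by_cases hb : ∀ x, b x = 0
  · refine Or.inl fun x => ⟨hb x, ?_⟩
    have := (T.commute_adjoint hi x x).1
    rw [hb] at this
    simpa using this
  · push Not at hb
    obtain ⟨y, hy⟩ := hb
    refine Or.inr ⟨⟨y, hy⟩, ?_⟩
    have hy2 := (T.commute_adjoint hi y y).1
    have h0 : (c y - b y) * (c y + b y) = 0 := by linear_combination hy2
    rcases mul_eq_zero.1 h0 with h | h
    · left
      have hcy : c y = b y := sub_eq_zero.1 h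
      have hc : ∀ x, c x = b x := fun x => by
        have := (T.commute_adjoint hi x y).1
        rw [hcy] at this
        exact mul_left_cancel₀ hy this
      have hey : a y = d y := by
        have := (T.commute_adjoint hi y y).2.1
        rw [hcy] at this
        refine mul_left_cancel₀ hy ?_
        linear_combination this / 2
      refine fun x => ⟨hc x, ?_⟩
      have := (T.commute_adjoint hi x y).2.1
      rw [hey, sub_self, zero_mul] at this
      exact (sub_eq_zero.1 ((mul_eq_zero.1 this.symm).resolve_left hy)).symm
    · right
      have hcy : c y = -b y := eq_neg_of_add_eq_zero_left h
      have hc : ∀ x, c x = -b x := fun x => by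
        have := (T.commute_adjoint hi x y).1
        rw [hcy] at this
        refine mul_left_cancel₀ hy ?_
        linear_combination -this
      refine ⟨(a y - d y) / b y, fun x => ⟨hc x, ?_⟩⟩
      have := (T.commute_adjoint hi x y).2.1
      rw [hc] at this
      field_simp
      linear_combination this

/-! ### Solving the three shapes of transfer matrices. -/

theorem family6 (T : IsTransfer σ α g f a b c d) (hi : Independent g f)
    (hbc : ∀ x, b x = 0 ∧ c x = 0) : Family6 σ α g f := by
  have hb := fun x => (hbc x).1
  have hc := fun x => (hbc x).2
  have hga : ∀ x, g x = a x := fun x => by rw [T.eq_g, hb]; ring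
  have hfd : ∀ x, f x = α * d x := fun x => by rw [T.eq_f, hc]; ring
  have hα : α ≠ 0 := by
    rintro rfl
    exact one_ne_zero (hi 0 1 fun x => by rw [hfd]; ring).2
  have ha0 : ∃ x, a x ≠ 0 := by
    by_contra! h
    exact one_ne_zero (hi 1 0 fun x => by rw [hga, h]; ring).1
  have hd0 : ∃ x, d x ≠ 0 := by
    by_contra! h
    exact one_ne_zero (hi 0 1 fun x => by rw [hfd, h]; ring).2
  have hm := T.mul_entries hi
  have hdef := T.defect hi
  simp only [hb, hc] at hm hdef
  refine ⟨hα, ⟨d, fun x y => by rw [(hm x y).2.2]; ring⟩,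
    ⟨a, fun x y => by rw [(hm x y).1.1]; ring⟩, fun h => ?_, fun h => ?_, fun h => ?_,
    fun y => ?_, fun y => ?_, hfd, hga⟩
  · have h' : ∀ x, d x = a x := fun x => DFunLike.congr_fun h x
    exact one_ne_zero (neg_eq_zero.1 (hi α (-1) fun x => by rw [hga, hfd, h' x]; ring).2)
  · obtain ⟨x, hx⟩ := hd0
    exact hx (congrFun h x)
  · obtain ⟨x, hx⟩ := ha0
    exact hx (congrFun h x)
  · obtain ⟨x, hx⟩ := hd0
    have := (hdef x y).2
    rw [hfd (σ y)] at this
    have h2 : d x * α * (d y - d (σ y)) = 0 := by linear_combination this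
    exact (sub_eq_zero.1 ((mul_eq_zero.1 h2).resolve_left (mul_ne_zero hx hα))).symm
  · obtain ⟨x, hx⟩ := ha0
    have := (hdef x y).1
    rw [hga (σ y)] at this
    have h2 : a x * (a y - a (σ y)) = 0 := by linear_combination this
    exact (sub_eq_zero.1 ((mul_eq_zero.1 h2).resolve_left hx)).symm

/-- The eigenvalues `d + b` and `d - b` are multiplicative. The adjoint changes the sign of `b`, so
`defect` shows that `σ` interchanges them. -/
theorem family8 (T : IsTransfer σ α g f a b c d) (hi : Independent g f)
    (hb0 : ∃ x, b x ≠ 0) (hN : ∀ x, c x = b x ∧ a x = d x) : Family8 σ α g f := by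
  have hc := fun x => (hN x).1
  have ha := fun x => (hN x).2
  have hg : ∀ x, g x = d x + α * b x := fun x => by rw [T.eq_g, ha]
  have hf : ∀ x, f x = b x + α * d x := fun x => by rw [T.eq_f, hc]
  have hα1 : α ≠ 1 := by
    rintro rfl
    exact one_ne_zero (hi 1 (-1) fun x => by rw [hg, hf]; ring).1
  have hα2 : α ≠ -1 := by
    rintro rfl
    exact one_ne_zero (hi 1 1 fun x => by rw [hg, hf]; ring).1
  have hm := T.mul_entries hi
  have hdef := T.defect hi
  simp only [hc, ha] at hm hdef
  have hp0 : ∃ x, d x + b x ≠ 0 := by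
    by_contra! h
    exact one_ne_zero (hi 1 1 fun x => by rw [hg, hf]; linear_combination (1 + α) * h x).1
  have hn0 : ∃ x, d x - b x ≠ 0 := by
    by_contra! h
    exact one_ne_zero (hi 1 (-1) fun x => by rw [hg, hf]; linear_combination (1 - α) * h x).1
  have hα1' : 1 - α ≠ 0 := sub_ne_zero.2 hα1.symm
  have hα2' : 1 + α ≠ 0 := fun h => hα2 (by linear_combination h)
  have hσ' : ∀ y, d (σ y) + b (σ y) = d y - b y := by
    intro y
    have h1 : d y - d (σ y) - (b y + b (σ y)) = 0 := by
      obtain ⟨x, hx⟩ := hp0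
      have := hdef x y
      rw [hg (σ y), hf (σ y)] at this
      have h2 : (d x + b x) * (1 + α) * (d y - d (σ y) - (b y + b (σ y))) = 0 := by
        linear_combination this.1 + this.2
      exact (mul_eq_zero.1 h2).resolve_left (mul_ne_zero hx hα2')
    linear_combination -h1
  have hσ'' : ∀ y, d (σ y) - b (σ y) = d y + b y := by
    intro y
    have h1 : d y - d (σ y) + (b y + b (σ y)) = 0 := by
      obtain ⟨x, hx⟩ := hn0
      have := hdef x y
      rw [hg (σ y), hf (σ y)] at this
      have h2 : (d x - b x) * (1 - α) * (d y - d (σ y) + (b y + b (σ y))) = 0 := by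
        linear_combination this.1 - this.2
      exact (mul_eq_zero.1 h2).resolve_left (mul_ne_zero hx hα1')
    linear_combination -h1
  refine ⟨hα1, hα2, ⟨fun x => d x + b x, fun x y => ?_⟩, fun h => ?_, fun x => ?_, fun x => ?_⟩
  · linear_combination (hm x y).2.2 + (hm x y).1.2
  · obtain ⟨x, hx⟩ := hb0
    have h2 : d (σ x) + b (σ x) = d x + b x := h x
    exact hx (by linear_combination (hσ' x - h2) / 2)
  · change f x = (1 + α) / 2 * (d x + b x) - (1 - α) / 2 * (d (σ x) + b (σ x))
    rw [hσ', hf]; ring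
  · change g x = (1 + α) / 2 * (d x + b x) + (1 - α) / 2 * (d (σ x) + b (σ x))
    rw [hσ', hg]; ring

/-- The case in which the transfer matrices are self-adjoint but not all diagonal. -/
theorem family567 (hσ : Function.Involutive σ) (T : IsTransfer σ α g f a b c d)
    (hi : Independent g f) {k : ℂ} (hb0 : ∃ x, b x ≠ 0)
    (hN : ∀ x, c x = -b x ∧ a x = d x + k * b x) :
    Family5 σ α g f ∨ Family6 σ α g f ∨ Family7 σ hσ α g f := by
  have hc := fun x => (hN x).1
  have ha := fun x => (hN x).2
  have hg : ∀ x, g x = d x + (k + α) * b x := fun x => by rw [T.eq_g, ha]; ring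
  have hf : ∀ x, f x = α * d x - b x := fun x => by rw [T.eq_f, hc]; ring
  have hm := T.mul_entries hi
  have hdef := T.defect hi
  simp only [hc, ha] at hm hdef
  -- Up to sign, the determinant of the change of basis from `d, b` to `g, f`.
  have hdet : 1 + α * (k + α) ≠ 0 := fun h =>
    one_ne_zero (neg_eq_zero.1 (hi α (-1) fun x => by
      rw [hg, hf]; linear_combination b x * h).2)
  have hind : Independent b d := by
    intro u v h
    obtain ⟨h1, h2⟩ := hi (u * α + v) (-u + v * (k + α)) fun x => by
      rw [hg, hf]; linear_combination (1 + α * (k + α)) * h x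
    constructor
    · refine (mul_eq_zero.1 ?_).resolve_left hdet
      linear_combination (k + α) * h1 - h2
    · refine (mul_eq_zero.1 ?_).resolve_left hdet
      linear_combination h1 + α * h2
  -- Here the adjoint of `M(y)` is `M(y)`, so the defect is `(g, f)(y) - (g, f)(σ y)`.
  have hev : ∀ y, g (σ y) = g y ∧ f (σ y) = f y := by
    intro y
    obtain ⟨h1, h2⟩ := hind (k * (g y - g (σ y)) + (f y - f (σ y))) (g y - g (σ y)) fun x => by
      have := (hdef x y).1
      rw [hg y, hf y]
      linear_combination this
    have h3 : g (σ y) = g y := (sub_eq_zero.1 h2).symm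
    refine ⟨h3, ?_⟩
    rw [h3] at h1
    linear_combination -h1
  have hbσ : ∀ y, b (σ y) = b y := by
    intro y
    have h1 := (hev y).1
    have h2 := (hev y).2
    rw [hg, hg] at h1
    rw [hf, hf] at h2
    refine mul_left_cancel₀ hdet ?_
    linear_combination α * h1 - h2
  have hdσ : ∀ y, d (σ y) = d y := by
    intro y
    have h1 := (hev y).1
    rw [hg, hg, hbσ] at h1
    exact add_right_cancel h1
  -- `M = d·1 + b·N`, where `N` has characteristic polynomial `l² - kl + 1`; each root gives the
  -- eigenvalue `d + l b` of `M`.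
  have hchar : ∀ l : ℂ, l ^ 2 - k * l + 1 = 0 → ∃ χ : S →ₙ* ℂ,
      (∀ x, χ x = d x + l * b x) ∧ (χ : S → ℂ) ≠ 0 ∧ IsEven σ χ := by
    intro l hl
    refine ⟨⟨fun x => d x + l * b x, fun x y => ?_⟩, fun x => rfl, fun h => ?_, fun x => ?_⟩
    · linear_combination (hm x y).2.2 + l * (hm x y).1.2 - b x * b y * hl
    · exact one_ne_zero (hind l 1 fun x => by
        have : d x + l * b x = 0 := congrFun h x
        linear_combination this).2
    · change d (σ x) + l * b (σ x) = d x + l * b x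
      rw [hbσ, hdσ]
  obtain ⟨δ, hδ⟩ : ∃ δ : ℂ, δ ^ 2 = k ^ 2 - 4 := ⟨_, Complex.cpow_nat_inv_pow _ two_ne_zero⟩
  obtain ⟨χ₁, h₁, n₁, e₁⟩ := hchar ((k + δ) / 2) (by linear_combination hδ / 4)
  obtain ⟨χ₂, h₂, n₂, e₂⟩ := hchar ((k - δ) / 2) (by linear_combination hδ / 4)
  by_cases hδ0 : δ = 0
  · subst hδ0
    right; right
    have hl : k / 2 = 1 ∨ k / 2 = -1 := sq_eq_one_iff.1 (by linear_combination -hδ / 4)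
    have h₁' : ∀ x, χ₁ x = d x + k / 2 * b x := fun x => by rw [h₁]; ring
    obtain ⟨l, rfl⟩ : ∃ l, k = 2 * l := ⟨k / 2, by ring⟩
    rw [mul_div_cancel_left₀ l two_ne_zero] at hl
    simp only [mul_div_cancel_left₀ l (two_ne_zero (α := ℂ))] at h₁'
    -- With double root `l = ±1`, this `h` is `f - α χ₁` rewritten using `l² = 1`.
    refine SineLaw.family7 hσ (χ := χ₁) (h := fun x => -l * (α + l) * b x)
      (fun x y => ?_) e₁ (fun x => ?_) n₁ (fun x => ?_) ?_
    · rw [h₁', h₁']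
      linear_combination (-l * (α + l)) * (hm x y).1.2
    · simp only [hbσ]
    · rw [hf, h₁']
      rcases hl with rfl | rfl <;> ring
    · rcases hl with rfl | rfl
      · exact Or.inr fun x => by rw [hg, h₁']; ring
      · exact Or.inl fun x => by rw [hg, h₁']; ring
  · have hne : χ₁ ≠ χ₂ := by
      rintro rfl
      obtain ⟨x, hx⟩ := hb0
      have := (h₁ x).symm.trans (h₂ x)
      exact mul_ne_zero hδ0 hx (by linear_combination this)
    have hf' : ∀ x, f x = α * ((χ₁ x + χ₂ x) / 2) + (-(α * k + 2) / δ) * ((χ₁ x - χ₂ x) / 2) := by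
      intro x
      rw [hf, h₁, h₂]; field_simp; ring
    have hg' : ∀ x, g x = (χ₁ x + χ₂ x) / 2 + ((k + 2 * α) / δ) * ((χ₁ x - χ₂ x) / 2) := by
      intro x
      rw [hg, h₁, h₂]; field_simp; ring
    have hs : ((k + 2 * α) / δ) ^ 2 = 1 + (-(α * k + 2) / δ) ^ 2 - α ^ 2 := by
      field_simp
      linear_combination (α ^ 2 - 1) * hδ
    generalize -(α * k + 2) / δ = q at *
    generalize (k + 2 * α) / δ = s at *
    -- If `q² = α²` then `s² = 1`, so `f` and `g` are each a multiple of one character; independence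
    -- excludes the same one.
    by_cases hq : q ^ 2 = α ^ 2
    · right; left
      have hf0 : α ≠ 0 := by
        rintro rfl
        have : q = 0 := by simpa using hq
        exact one_ne_zero (hi 0 1 fun x => by rw [hf', this]; ring).2
      have hs1 : s = 1 ∨ s = -1 := sq_eq_one_iff.1 (by linear_combination hs + hq)
      rcases sq_eq_sq_iff_eq_or_eq_neg.1 hq with rfl | rfl <;> rcases hs1 with rfl | rfl
      · exact absurd (hi q (-1) fun x => by rw [hf', hg']; ring).2 (by norm_num)
      · exact ⟨hf0, χ₁, χ₂, hne, n₁, n₂, e₁, e₂, fun x => by rw [hf']; ring,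
          fun x => by rw [hg']; ring⟩
      · exact ⟨hf0, χ₂, χ₁, hne.symm, n₂, n₁, e₂, e₁, fun x => by rw [hf']; ring,
          fun x => by rw [hg']; ring⟩
      · exact absurd (hi α (-1) fun x => by rw [hf', hg']; ring).2 (by norm_num)
    · left
      exact ⟨q, s, χ₁, χ₂, hs, fun h => hq (by rw [h]), fun h => hq (by rw [h]; ring), hne, n₁,
        n₂, e₁, e₂, hf', Or.inl hg'⟩

end IsTransfer

theorem IsSolution.regularFamilies_of_independent {σ : S ≃* S} (hσ : Function.Involutive σ)
    {α : ℂ} {g f : S → ℂ} (H : IsSolution σ α g f) (hi : Independent g f) :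
    RegularFamilies σ hσ α g f := by
  obtain ⟨a, b, c, d, T⟩ := H.exists_isTransfer hi
  unfold RegularFamilies
  rcases T.trichotomy hi with h | ⟨hb, h | ⟨k, h⟩⟩
  · have := T.family6 hi h; tauto
  · have := T.family8 hi hb h; tauto
  · have := T.family567 hσ hi hb h; tauto

/-! ### Linearly dependent solutions. -/

theorem family4_zero [Nonempty S] (σ : S ≃* S) (α : ℂ) :
    Family4 σ α (fun _ => 0) (fun _ => 0) := by
  refine ⟨-α, 1, 1, by ring, fun h => ?_, fun x => rfl, fun x => by ring,
    Or.inr fun x => by ring⟩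
  obtain ⟨x⟩ := ‹Nonempty S›
  exact one_ne_zero (congrFun h x : (1 : ℂ) = 0)

theorem IsSolution.families_of_smul [Nonempty S] {σ : S ≃* S} (hσ : Function.Involutive σ)
    {α : ℂ} {g f k : S → ℂ} {u v : ℂ} (hk : k ≠ 0) (hg : g = fun x => u * k x)
    (hf : f = fun x => v * k x) (H : IsSolution σ α g f) :
    Family1 α g f ∨ RegularFamilies σ hσ α g f := by
  subst hg hf
  have hE : ∀ x y, (u - α * v) * k (x * σ y) = (u ^ 2 - v ^ 2) * (k x * k y) := fun x y => by
    have := H x y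
    simp only at this
    linear_combination this
  obtain ⟨p, hp⟩ := Function.ne_iff.1 hk
  have hp : k p ≠ 0 := hp
  unfold RegularFamilies
  have hsmul : ∀ w : ℂ, w ≠ 0 → (fun x => w * k x) ≠ 0 := fun w hw h =>
    mul_ne_zero hw hp (congrFun h p)
  by_cases hw : u - α * v = 0
  · have huv : u ^ 2 - v ^ 2 = 0 := by
      have := hE p p
      rw [hw, zero_mul] at this
      exact (mul_eq_zero.1 this.symm).resolve_right (mul_ne_zero hp hp)
    have hu : u = α * v := sub_eq_zero.1 hw
    subst hu
    by_cases hv : v = 0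
    · subst hv
      have := family4_zero σ α
      simp only [mul_zero, zero_mul]
      tauto
    · left
      refine ⟨sq_eq_one_iff.1 ?_, hsmul v hv, fun x => mul_assoc _ _ _⟩
      refine mul_right_cancel₀ (pow_ne_zero 2 hv) ?_
      linear_combination huv
  · right
    by_cases huv : u ^ 2 - v ^ 2 = 0
    · have h0 : ∀ x y, k (x * y) = 0 := fun x y => by
        have := hE x (σ y)
        rw [huv, zero_mul, hσ y] at this
        exact (mul_eq_zero.1 this).resolve_left hw
      have hV : VanishesOnProducts (fun x => u * k x) := fun x y => by simp only [h0, mul_zero]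
      have hu0 : u ≠ 0 := by
        rintro rfl
        have : v = 0 := by simpa using huv
        exact hw (by rw [this]; ring)
      rcases sq_eq_sq_iff_eq_or_eq_neg.1 (sub_eq_zero.1 huv) with h | h
      · refine Or.inl ⟨?_, ?_, hsmul u hu0, hV⟩
        · rintro rfl
          exact hw (by rw [h]; ring)
        · rw [h]
      · refine Or.inr (Or.inl ⟨?_, ?_, hsmul u hu0, hV⟩)
        · rintro rfl
          exact hw (by rw [h]; ring)
        · funext x
          simp only [h, Pi.neg_apply]
          ring
    · refine Or.inr (Or.inr (Or.inl ?_))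
      obtain ⟨e, he⟩ : ∃ e, e * (u - α * v) = u ^ 2 - v ^ 2 :=
        ⟨(u ^ 2 - v ^ 2) / (u - α * v), div_mul_cancel₀ _ hw⟩
      have he0 : e ≠ 0 := by
        rintro rfl
        exact huv (by rw [← he]; ring)
      have hM : ∀ x y, k (x * σ y) = e * (k x * k y) := fun x y =>
        mul_left_cancel₀ hw (by linear_combination hE x y - (k x * k y) * he)
      -- Evenness comes from expanding `k(p σ(p) σ(y))` with either bracketing.
      have hev : ∀ y, k (σ y) = k y := fun y => by
        have h1 := hM p (p * y)
        have h2 := hM p (σ y)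
        rw [hσ y] at h2
        rw [map_mul, ← mul_assoc, hM, hM, h2] at h1
        refine mul_left_cancel₀ (mul_ne_zero (pow_ne_zero 2 he0) (mul_ne_zero hp hp)) ?_
        linear_combination -h1
      -- The constants solve `v = (q + α)e/2` and `u = (1 + s)e/2` for `χ = e k`.
      refine ⟨2 * v / e - α, 2 * u / e - 1, ⟨fun x => e * k x, fun x y => ?_⟩, ?_, ?_,
        fun x => ?_, fun x => ?_, Or.inl fun x => ?_⟩
      · have := hM x (σ y)
        rw [hσ y, hev] at this
        rw [this]; ring
      · field_simp
        linear_combination -4 * he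
      · exact hsmul e he0
      · change e * k (σ x) = e * k x
        rw [hev]
      · change v * k x = (2 * v / e - α + α) * (e * k x / 2)
        field_simp
        ring
      · change u * k x = (1 + (2 * u / e - 1)) * (e * k x / 2)
        field_simp
        ring

theorem IsSolution.families [Nonempty S] {σ : S ≃* S} (hσ : Function.Involutive σ) {α : ℂ}
    {g f : S → ℂ} (H : IsSolution σ α g f) :
    Family1 α g f ∨ RegularFamilies σ hσ α g f := by
  by_cases hi : Independent g f
  · exact Or.inr (H.regularFamilies_of_independent hσ hi)
  by_cases hf : f = 0
  · by_cases hg : g = 0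
    · subst hf hg
      have : Family4 σ α 0 0 := family4_zero σ α
      unfold RegularFamilies
      tauto
    · exact H.families_of_smul hσ hg (u := 1) (v := 0) (by simp) (by rw [hf]; funext x; simp)
  · obtain ⟨u, hu⟩ := exists_smul_of_not_independent hi hf
    exact H.families_of_smul hσ hf hu (v := 1) (by simp)

/-! ### Continuity of `g`. -/

/-- If some `b y ≠ 0`, `right_f` expresses `g` through `f` and its right translate by `σ y`. If `b =
0`, then `f = α d` with `d` multiplicative and continuous, the excluded case. -/
theorem IsSolution.continuous [TopologicalSpace S] [ContinuousMul S] {σ : S ≃* S} {α : ℂ}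
    {g f : S → ℂ} (H : IsSolution σ α g f) (hc : Continuous f)
    (hn : ¬ ∃ χ : S →ₙ* ℂ, Continuous χ ∧ ∀ x, f x = α * χ x) : Continuous g := by
  by_cases hi : Independent g f
  · obtain ⟨a, b, c, d, T⟩ := H.exists_isTransfer hi
    by_cases hb : ∀ x, b x = 0
    · have hc0 : ∀ x, c x = 0 := fun x => by
        have := (T.commute_adjoint hi x x).1
        rw [hb] at this
        simpa using this
      have hfd : ∀ x, f x = α * d x := fun x => by rw [T.eq_f, hc0]; ring
      have hα : α ≠ 0 := by
        rintro rfl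
        exact one_ne_zero (hi 0 1 fun x => by rw [hfd]; ring).2
      refine absurd ⟨⟨d, fun x y => ?_⟩, ?_, hfd⟩ hn
      · rw [(T.mul_entries hi x y).2.2, hc0]; ring
      · have : d = fun x => f x / α := funext fun x => by rw [hfd]; field_simp
        change Continuous d
        rw [this]
        exact hc.div_const α
    · push Not at hb
      obtain ⟨y, hy⟩ := hb
      have : g = fun w => (d y * f w - f (w * σ y)) / b y := funext fun w => by
        rw [T.right_f]; field_simp; ring
      rw [this]
      have h1 : Continuous fun w => f (w * σ y) := hc.comp (continuous_mul_const (σ y))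
      exact ((hc.const_mul (d y)).sub h1).div_const (b y)
  · by_cases hf : f = 0
    · exact absurd ⟨⟨fun _ => 0, fun x y => (mul_zero 0).symm⟩, continuous_const, fun x => by
        rw [hf]; exact (mul_zero α).symm⟩ hn
    · obtain ⟨u, rfl⟩ := exists_smul_of_not_independent hi hf
      exact hc.const_mul u

end CosineLaw

theorem mainTheorem2 {S : Type*} [Semigroup S] [Nonempty S]
    (σ : S ≃* S) (hσ : Function.Involutive σ) (α : ℂ) :
    (∀ g f : S → ℂ, CosineLaw.IsSolution σ α g f ↔
      (CosineLaw.Family1 α g f ∨ CosineLaw.RegularFamilies σ hσ α g f)) ∧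
    (∀ g f : S → ℂ, CosineLaw.RegularFamilies σ hσ α g f →
      CosineLaw.IsAbelian g ∧ CosineLaw.IsAbelian f) ∧
    (∀ [TopologicalSpace S] [ContinuousMul S] (g f : S → ℂ),
      CosineLaw.IsSolution σ α g f → Continuous f →
      (¬ ∃ χ : S →ₙ* ℂ, Continuous χ ∧ ∀ x, f x = α * χ x) → Continuous g) :=
  ⟨fun _ _ => ⟨fun H => H.families hσ, fun H => H.elim (·.isSolution σ) (·.isSolution)⟩,
    fun _ _ H => H.isAbelian, fun _ _ H hc hn => H.continuous hc hn⟩
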